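/- Let $q>2$ be a real number and let $f(z)=\sum_{k\ge 1} a_k z^{n_k}$ be a power series with complex coefficients $a_k\neq 0$ and exponents $n_k\in\mathbb N$ that converges on the unit disc, satisfies $|f(z)|\le 1$ there, and satisfies $$ n_k^2 < n_{k+1}\le n_k^{\,q}\qquad\text{for all } k\ge 1 .$$ For $d\ge 1$ let $\nu_d(f)$ be the maximal multiplicity at $0$ of $z\mapsto P(z,f(z))$ over all nonzero polynomials $P\in\mathbb C[z,y]$ of total degree at most $d$, and let $\mathcal Z_d(f)$ be the maximal number of zeros, in the closed disc $D_{1/4}=\{|z|\le 1/4\}$, of $\sum_{j=0}^d p_j(z)f(z)^j$ over all $p_0,\dots,p_d\in\mathbb C[z]$ of degree at most $d$ that are not all zero. Then the sequence $(\nu_d(f))_{d\ge1}$ is finite and grows at most polynomially in $d$; more precisely, for every integer $d\ge n_1$, $$ \nu_d(f) < d^{\,q^2}.$$ If, in addition, for some $p>0$ one has $|a_k|\ge e^{-n_k^{\,p}}$ for all $k\ge 1$, then for every integer $d\ge n_1$ $$ \mathcal Z_d(f)\le 10\,(2d)^{q^2}\bigl(1+q\,d^2+5\,d^{\,pq+3}\bigr),$$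 whether the zeros are counted with or without multiplicity. -/

import Mathlib

open scoped Polynomial

noncomputable section

namespace Bezout

/-- The `d`-th transcendence index `ν_d(f)`: the largest multiplicity at `0` of `z ↦ P(z, f(z))`
over all nonzero complex polynomials `P` in two variables of total degree at most `d`
(`⊤` if these multiplicities are unbounded). -/
def transcendenceIndex (f : ℂ → ℂ) (d : ℕ) : ℕ∞ :=
  ⨆ (P : MvPolynomial (Fin 2) ℂ) (_ : P ≠ 0) (_ : P.totalDegree ≤ d),
    analyticOrderAt (fun z : ℂ => MvPolynomial.eval ![z, f z] P) 0

/-- The function `z ↦ ∑_{j=0}^d p_j(z) f(z)^j`. -/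
def polyCombination (f : ℂ → ℂ) {d : ℕ} (p : Fin (d + 1) → ℂ[X]) : ℂ → ℂ :=
  fun z => ∑ j : Fin (d + 1), (p j).eval z * f z ^ (j : ℕ)

/-- The number of zeros of `g` in `D`, counted with multiplicity: the supremum over the finite
subsets of `D` of the sum of the orders of vanishing of `g`. -/
def zeroCountMult (g : ℂ → ℂ) (D : Set ℂ) : ℕ∞ :=
  ⨆ (s : Finset ℂ) (_ : (s : Set ℂ) ⊆ D), ∑ z ∈ s, analyticOrderAt g z

/-- `𝒵_d(f)` on `D`, zeros counted without multiplicity: the largest number of points `z ∈ D`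
with `∑_{j=0}^d p_j(z) f(z)^j = 0`, over all polynomials `p_0, …, p_d` of degree at most `d`
that are not all zero (`⊤` if these numbers are unbounded). -/
def bezoutNumber (f : ℂ → ℂ) (D : Set ℂ) (d : ℕ) : ℕ∞ :=
  ⨆ (p : Fin (d + 1) → ℂ[X]) (_ : p ≠ 0) (_ : ∀ j, (p j).natDegree ≤ d),
    {z ∈ D | polyCombination f p z = 0}.encard

/-- `𝒵_d(f)` on `D`, zeros counted with multiplicity. -/
def bezoutNumberMult (f : ℂ → ℂ) (D : Set ℂ) (d : ℕ) : ℕ∞ :=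
  ⨆ (p : Fin (d + 1) → ℂ[X]) (_ : p ≠ 0) (_ : ∀ j, (p j).natDegree ≤ d),
    zeroCountMult (polyCombination f p) D

/-- The extended natural number `N` is finite and at most the real number `x`. -/
def BoundedBy (N : ℕ∞) (x : ℝ) : Prop := ∃ k : ℕ, N = k ∧ (k : ℝ) ≤ x

end Bezout

end

namespace Bezout

open Metric Filter Topology

/-! Choose consecutive exponents with n_K ≤ d < N = n_{K+1}, and let g be the partial sum of f of
degree N. Then f = g + O(z^L) with L = n_{K+2} > N² ≥ N(d+1) and L ≤ d^(q²) (`exists_partialSum`).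
So F = ∑ p_j f^j and Q = ∑ p_j g^j have the same coefficients below L. Since deg p_j ≤ d < N, Q is a
base-g expansion: the products z^i g^j with i < N have distinct degrees i + Nj. Hence Q is nonzero
of degree below N(d+1) ≤ L, and F vanishes to order less than L.

For zeros this is made quantitative. The coefficients of g^j below L are those of f^j, hence at most
1 by Cauchy. Back substitution (`sum_norm_coeff_le`) then gives some coefficient of F of index below
M = N(d+1) that is at least (|a|^d / 2)^M X, where a is the leading coefficient of g and X the sum
of the norms of the coefficients of the p_j. Conversely |F| ≤ X on the disc, and k zeros in |z| ≤
1/4 make F at most X (3/5)^k on |z| ≤ 1/8 (`norm_le_of_zeros`). Cauchy's estimate there bounds k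
(`pow_le_of_zeros`). -/

/-- On the unit disc, `F` differs from the polynomial `Q` by `z ^ L` times an analytic function. -/
def AgreesUpTo (L : ℕ) (F : ℂ → ℂ) (Q : ℂ[X]) : Prop :=
  ∃ H : ℂ → ℂ, DifferentiableOn ℂ H (ball 0 1) ∧
    ∀ z ∈ ball (0 : ℂ) 1, F z = Q.eval z + z ^ L * H z

/-! ### Arithmetic of expansions modulo z^L -/

namespace AgreesUpTo

variable {L : ℕ} {F G : ℂ → ℂ} {P Q : ℂ[X]}

theorem differentiableOn (h : AgreesUpTo L F Q) : DifferentiableOn ℂ F (ball 0 1) := by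
  obtain ⟨H, hH, e⟩ := h
  have h1 : DifferentiableOn ℂ (fun z => Q.eval z + z ^ L * H z) (ball 0 1) :=
    Q.differentiable.differentiableOn.add
      (((differentiable_id.pow L).differentiableOn).mul hH)
  exact h1.congr e

theorem of_polynomial (Q : ℂ[X]) : AgreesUpTo L (fun z => Q.eval z) Q :=
  ⟨fun _ => 0, differentiableOn_const 0, fun z _ => by simp⟩

theorem add (hF : AgreesUpTo L F P) (hG : AgreesUpTo L G Q) :
    AgreesUpTo L (fun z => F z + G z) (P + Q) := by
  obtain ⟨H, hH, e⟩ := hF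
  obtain ⟨K, hK, e'⟩ := hG
  refine ⟨fun z => H z + K z, hH.add hK, fun z hz => ?_⟩
  simp only [e z hz, e' z hz, Polynomial.eval_add]
  ring

theorem mul (hF : AgreesUpTo L F P) (hG : AgreesUpTo L G Q) :
    AgreesUpTo L (fun z => F z * G z) (P * Q) := by
  have hG' := hG.differentiableOn
  obtain ⟨H, hH, e⟩ := hF
  obtain ⟨K, hK, e'⟩ := hG
  refine ⟨fun z => P.eval z * K z + H z * G z,
    (P.differentiable.differentiableOn.mul hK).add (hH.mul hG'), fun z hz => ?_⟩
  simp only [e z hz, e' z hz, Polynomial.eval_mul]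
  ring

theorem pow (hF : AgreesUpTo L F P) (j : ℕ) : AgreesUpTo L (fun z => F z ^ j) (P ^ j) := by
  induction j with
  | zero => simpa using of_polynomial (L := L) 1
  | succ j ih => simpa only [pow_succ] using ih.mul hF

theorem sum {ι : Type*} (s : Finset ι) {F : ι → ℂ → ℂ} {P : ι → ℂ[X]}
    (h : ∀ i ∈ s, AgreesUpTo L (F i) (P i)) :
    AgreesUpTo L (fun z => ∑ i ∈ s, F i z) (∑ i ∈ s, P i) := by
  classical
  induction s using Finset.induction_on with
  | empty => simpa using of_polynomial (L := L) 0
  | insert i s hi ih =>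
    simp only [Finset.sum_insert hi]
    exact (h i (by simp)).add (ih fun k hk => h k (by simp [hk]))

theorem analyticAt (h : AgreesUpTo L F Q) {z : ℂ} (hz : z ∈ ball (0 : ℂ) 1) : AnalyticAt ℂ F z :=
  h.differentiableOn.analyticAt (isOpen_ball.mem_nhds hz)

theorem polyCombination (h : AgreesUpTo L F P) {d : ℕ} (p : Fin (d + 1) → ℂ[X]) :
    AgreesUpTo L (polyCombination F p) (∑ j, p j * P ^ (j : ℕ)) :=
  sum _ fun j _ => (of_polynomial (p j)).mul (h.pow j)

end AgreesUpTo

/-! ### Taylor coefficients and Cauchy estimates -/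

theorem iteratedDeriv_polynomial_eval (Q : ℂ[X]) (m : ℕ) :
    iteratedDeriv m (fun z => Q.eval z) = fun z => (Polynomial.derivative^[m] Q).eval z := by
  induction m with
  | zero => simp
  | succ m ih =>
    rw [iteratedDeriv_succ, ih, Function.iterate_succ_apply']
    funext z
    simp

theorem iteratedDeriv_polynomial_eval_zero (Q : ℂ[X]) (m : ℕ) :
    iteratedDeriv m (fun z => Q.eval z) 0 = m.factorial * Q.coeff m := by
  rw [iteratedDeriv_polynomial_eval]
  simp [← Polynomial.coeff_zero_eq_eval_zero, Polynomial.coeff_iterate_derivative,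
    Nat.descFactorial_self]

namespace AgreesUpTo

variable {L : ℕ} {F : ℂ → ℂ} {Q : ℂ[X]}

theorem iteratedDeriv_zero (h : AgreesUpTo L F Q) {m : ℕ} (hm : m < L) :
    iteratedDeriv m F 0 = m.factorial * Q.coeff m := by
  obtain ⟨H, hH, e⟩ := h
  have h0 : ball (0 : ℂ) 1 ∈ 𝓝 (0 : ℂ) := ball_mem_nhds _ one_pos
  have hHa : AnalyticAt ℂ H 0 := hH.analyticAt h0
  have hKa : AnalyticAt ℂ (fun z => z ^ L * H z) 0 := by fun_prop
  have hQa : AnalyticAt ℂ (fun z => Q.eval z) 0 :=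
    (Q.differentiable.differentiableOn (s := Set.univ)).analyticAt univ_mem
  have hK : iteratedDeriv m (fun z => z ^ L * H z) 0 = 0 :=
    (natCast_le_analyticOrderAt_iff_iteratedDeriv_eq_zero hKa).mp
      ((natCast_le_analyticOrderAt hKa).mpr ⟨H, hHa, by simp⟩) m hm
  have hEq : F =ᶠ[𝓝 0] fun z => Q.eval z + z ^ L * H z := eventually_of_mem h0 e
  rw [hEq.iteratedDeriv_eq m, iteratedDeriv_fun_add hQa.contDiffAt hKa.contDiffAt, hK, add_zero,
    iteratedDeriv_polynomial_eval_zero]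

theorem order_lt (h : AgreesUpTo L F Q) {m : ℕ} (hm : m < L) (hc : Q.coeff m ≠ 0) :
    analyticOrderAt F 0 < L := by
  by_contra hcon
  have := (natCast_le_analyticOrderAt_iff_iteratedDeriv_eq_zero
    (h.analyticAt (mem_ball_self one_pos))).mp (not_lt.mp hcon) m hm
  rw [h.iteratedDeriv_zero hm] at this
  simp [hc, Nat.factorial_ne_zero] at this

theorem norm_coeff_mul_pow_le (h : AgreesUpTo L F Q) {m : ℕ} (hm : m < L) {r C : ℝ} (hr : 0 < r)
    (hr1 : r < 1) (hC : ∀ z ∈ sphere (0 : ℂ) r, ‖F z‖ ≤ C) : ‖Q.coeff m‖ * r ^ m ≤ C := by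
  have hd : DiffContOnCl ℂ F (ball 0 r) :=
    h.differentiableOn.diffContOnCl_ball (closedBall_subset_ball hr1)
  have := Complex.norm_iteratedDeriv_le_of_forall_mem_sphere_norm_le m hr hd hC
  rw [h.iteratedDeriv_zero hm, norm_mul, Complex.norm_natCast, mul_div_assoc] at this
  have h2 := le_of_mul_le_mul_left this (by exact_mod_cast m.factorial_pos)
  rwa [le_div_iff₀ (pow_pos hr m)] at h2

/-- Cauchy's estimate on the circle of radius r, followed by r → 1. -/
theorem norm_coeff_le_one (h : AgreesUpTo L F Q) {m : ℕ} (hm : m < L)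
    (hC : ∀ z ∈ ball (0 : ℂ) 1, ‖F z‖ ≤ 1) : ‖Q.coeff m‖ ≤ 1 := by
  have h1 : ∀ᶠ r : ℝ in 𝓝[<] 1, ‖Q.coeff m‖ * r ^ m ≤ 1 := by
    filter_upwards [Ioo_mem_nhdsLT (zero_lt_one (α := ℝ))] with r hr
    refine h.norm_coeff_mul_pow_le hm hr.1 hr.2 fun z hz => hC z ?_
    rw [mem_ball, mem_sphere.mp hz]
    exact hr.2
  have h2 : Tendsto (fun r : ℝ => ‖Q.coeff m‖ * r ^ m) (𝓝[<] 1) (𝓝 (‖Q.coeff m‖ * 1 ^ m)) :=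
    (Continuous.tendsto (by fun_prop) _).mono_left nhdsWithin_le_nhds
  simpa using le_of_tendsto h2 h1

end AgreesUpTo

/-! ### Many zeros force smallness -/

theorem exists_eq_sub_mul {F : ℂ → ℂ} (hF : DifferentiableOn ℂ F (ball 0 1)) {w : ℂ}
    (hw : w ∈ ball (0 : ℂ) 1) (h0 : F w = 0) :
    ∃ G : ℂ → ℂ, DifferentiableOn ℂ G (ball 0 1) ∧ ∀ z, F z = (z - w) * G z := by
  refine ⟨dslope F w, (Complex.differentiableOn_dslope (isOpen_ball.mem_nhds hw)).mpr hF,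
    fun z => ?_⟩
  have := sub_smul_dslope F w z
  rw [h0, sub_zero, smul_eq_mul] at this
  exact this.symm

/-- A function bounded by `C` on the circle of radius `7 / 8` with `k` zeros in the disc of radius
`1 / 4` is at most `C (3 / 5) ^ k` on the disc of radius `1 / 8`. -/
theorem norm_le_of_zeros (s : Finset ℂ) (hs : ∀ w ∈ s, ‖w‖ ≤ 1 / 4) (k : ℕ) :
    ∀ (F : ℂ → ℂ) (C : ℝ), DifferentiableOn ℂ F (ball 0 1) →
      (∀ z ∈ sphere (0 : ℂ) (7 / 8), ‖F z‖ ≤ C) → (k : ℕ∞) ≤ ∑ z ∈ s, analyticOrderAt F z →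
      ∀ z : ℂ, ‖z‖ ≤ 1 / 8 → ‖F z‖ ≤ C * (3 / 5) ^ k := by
  induction k with
  | zero =>
    intro F C hF hC _ z hz
    have hd : DiffContOnCl ℂ F (ball 0 (7 / 8)) :=
      hF.diffContOnCl_ball (closedBall_subset_ball (by norm_num))
    have hfr : ∀ z ∈ frontier (ball (0 : ℂ) (7 / 8)), ‖F z‖ ≤ C := by
      rwa [frontier_ball (0 : ℂ) (by norm_num : (7 / 8 : ℝ) ≠ 0)]
    simpa using Complex.norm_le_of_forall_mem_frontier_norm_le isBounded_ball hd hfr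
      (subset_closure (by rw [mem_ball_zero_iff]; linarith))
  | succ k ih =>
    intro F C hF hC hk z hz
    obtain ⟨w, hws, hw⟩ : ∃ w ∈ s, analyticOrderAt F w ≠ 0 := by
      by_contra! hcon
      rw [Finset.sum_eq_zero hcon] at hk
      simp at hk
    have hball : ∀ u ∈ s, u ∈ ball (0 : ℂ) 1 := fun u hu => by
      rw [mem_ball_zero_iff]; linarith [hs u hu]
    obtain ⟨G, hG, e⟩ := exists_eq_sub_mul hF (hball w hws)
      (apply_eq_zero_of_analyticOrderAt_ne_zero hw)
    have hF' : F = (fun z => z - w) * G := funext e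
    have hord : ∀ u ∈ s, analyticOrderAt F u = (if u = w then 1 else 0) + analyticOrderAt G u := by
      intro u hu
      rw [hF', analyticOrderAt_mul (by fun_prop)
        (hG.analyticAt (isOpen_ball.mem_nhds (hball u hu)))]
      congr 1
      split_ifs with huw
      · rw [huw]
        exact analyticOrderAt_id_sub_const_self
      · rw [AnalyticAt.analyticOrderAt_eq_zero (by fun_prop)]
        exact sub_ne_zero.mpr huw
    rw [Finset.sum_congr rfl hord, Finset.sum_add_distrib, Finset.sum_ite_eq', if_pos hws,
      Nat.cast_add, add_comm, Nat.cast_one] at hk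
    have hk' : (k : ℕ∞) ≤ ∑ z ∈ s, analyticOrderAt G z :=
      (ENat.add_le_add_iff_left (by simp)).mp hk
    have hwn := hs w hws
    -- Dividing by z - w costs 7/8 - 1/4 = 5/8 on the large circle; multiplying back gains 1/8 + 1/4
    -- = 3/8 on the small disc. Each zero thus contributes the factor 3/5.
    have hCG : ∀ z ∈ sphere (0 : ℂ) (7 / 8), ‖G z‖ ≤ C / (5 / 8) := by
      intro z hz
      have h1 := hC z hz
      rw [e, norm_mul] at h1
      rw [mem_sphere_zero_iff_norm] at hz
      have h2 : 5 / 8 ≤ ‖z - w‖ := by linarith [norm_sub_norm_le z w]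
      rw [le_div_iff₀ (by norm_num), mul_comm]
      exact (mul_le_mul_of_nonneg_right h2 (norm_nonneg _)).trans h1
    have h3 := ih G _ hG hCG hk' z hz
    rw [e, norm_mul]
    calc ‖z - w‖ * ‖G z‖ ≤ (3 / 8) * (C / (5 / 8) * (3 / 5) ^ k) := by
          gcongr
          linarith [norm_sub_le z w]
      _ = C * (3 / 5) ^ (k + 1) := by ring

/-! ### Triangular systems and base-g expansions -/

/-- Back substitution from the last unknown: if S is ε plus the later unknowns, the next one is at
most S/β, and S ≤ S/β because β ≤ 1, so each step costs a factor 2/β. -/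
theorem sum_le_of_triangular {β ε : ℝ} (hβ : 0 < β) (hβ1 : β ≤ 1) (M : ℕ) :
    ∀ x : ℕ → ℝ, (∀ t, 0 ≤ x t) → 0 ≤ ε →
      (∀ t < M, β * x t ≤ ε + ∑ u ∈ Finset.Ico (t + 1) M, x u) →
      ε + ∑ t ∈ Finset.range M, x t ≤ (2 / β) ^ M * ε := by
  induction M with
  | zero => intro x _ _ _; simp
  | succ M ih =>
    intro x hx hε h
    have h1 := ih (fun t => x (t + 1)) (fun t => hx _) hε fun t ht => by
      have := h (t + 1) (by omega)
      rwa [← Finset.sum_Ico_add' x (t + 1) M 1] at this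
    have h2 := h 0 (by omega)
    rw [← Finset.sum_Ico_add' x 0 M 1, ← Finset.range_eq_Ico] at h2
    rw [Finset.sum_range_succ']
    set S := ε + ∑ t ∈ Finset.range M, x (t + 1) with hS
    have hS0 : 0 ≤ S := add_nonneg hε (Finset.sum_nonneg fun t _ => hx _)
    have h3 : x 0 ≤ S / β := by rw [le_div_iff₀ hβ]; linarith
    have h4 : S ≤ S / β := by rw [le_div_iff₀ hβ]; nlinarith
    calc ε + (∑ t ∈ Finset.range M, x (t + 1) + x 0) ≤ 2 / β * S := by
          rw [div_mul_eq_mul_div, mul_div_assoc]; linarith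
      _ ≤ 2 / β * ((2 / β) ^ M * ε) := by gcongr
      _ = _ := by ring

theorem sum_range_mul_divMod {A : Type*} [AddCommMonoid A] {N : ℕ} (hN : 0 < N) (m : ℕ)
    (φ : ℕ → ℕ → A) :
    ∑ t ∈ Finset.range (N * m), φ (t / N) (t % N) =
      ∑ j ∈ Finset.range m, ∑ i ∈ Finset.range N, φ j i := by
  induction m with
  | zero => simp
  | succ m ih =>
    rw [mul_add, mul_one, Finset.sum_range_add, ih, Finset.sum_range_succ]
    congr 1
    refine Finset.sum_congr rfl fun i hi => ?_
    have hi := Finset.mem_range.mp hi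
    rw [Nat.mul_add_div hN, Nat.mul_add_mod, Nat.div_eq_of_lt hi, Nat.mod_eq_of_lt hi, add_zero]

/-- A combination `∑ p_j g ^ j` with `deg p_j < deg g` has a coefficient that is not small
compared with the coefficients of the `p_j`. -/
theorem sum_norm_coeff_le {g : ℂ[X]} {N d : ℕ} (hN : 0 < N) (hg : g.natDegree = N)
    (ha1 : ‖g.coeff N‖ ≤ 1) (ha0 : g.coeff N ≠ 0) {p : ℕ → ℂ[X]} (hp : ∀ j, (p j).natDegree < N)
    (hgc : ∀ j ≤ d, ∀ m < N * (d + 1), ‖(g ^ j).coeff m‖ ≤ 1) {ε : ℝ} (hε : 0 ≤ ε)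
    (hQ : ∀ m < N * (d + 1),
      ‖(∑ j ∈ Finset.range (d + 1), p j * g ^ j).coeff m‖ ≤ ε) :
    ∑ j ∈ Finset.range (d + 1), ∑ i ∈ Finset.range N, ‖(p j).coeff i‖ ≤
      (2 / ‖g.coeff N‖ ^ d) ^ (N * (d + 1)) * ε := by
  have hβ : 0 < ‖g.coeff N‖ := norm_pos_iff.mpr ha0
  set M := N * (d + 1) with hM
  -- The index t = i + Nj encodes the pair (j, i). As `B t` has degree t, the system for the `c t`
  -- is triangular, with diagonal entries the powers of the leading coefficient of g.
  let c : ℕ → ℂ := fun t => (p (t / N)).coeff (t % N)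
  let B : ℕ → ℂ[X] := fun t => Polynomial.X ^ (t % N) * g ^ (t / N)
  have hBQ : ∑ j ∈ Finset.range (d + 1), p j * g ^ j =
      ∑ t ∈ Finset.range M, Polynomial.C (c t) * B t := by
    rw [hM, sum_range_mul_divMod hN (d + 1)
      (fun j i => Polynomial.C ((p j).coeff i) * (Polynomial.X ^ i * g ^ j))]
    refine Finset.sum_congr rfl fun j _ => ?_
    conv_lhs => rw [(p j).as_sum_range_C_mul_X_pow' (hp j)]
    rw [Finset.sum_mul]
    exact Finset.sum_congr rfl fun i _ => mul_assoc _ _ _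
  have hdiv : ∀ u < M, u / N ≤ d := fun u hu => by
    have := (Nat.div_lt_iff_lt_mul hN).mpr (show u < (d + 1) * N by rw [mul_comm]; exact hu)
    omega
  have hB1 : ∀ u < M, ∀ t < M, ‖(B u).coeff t‖ ≤ 1 := by
    intro u hu t ht
    rw [Polynomial.coeff_X_pow_mul']
    split_ifs
    · exact hgc _ (hdiv u hu) _ (by omega)
    · simp
  have hB0 : ∀ t, ∀ u < t, (B u).coeff t = 0 := by
    intro t u hu
    refine Polynomial.coeff_eq_zero_of_natDegree_lt (lt_of_le_of_lt ?_ hu)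
    refine Polynomial.natDegree_mul_le.trans ?_
    rw [Polynomial.natDegree_X_pow, Polynomial.natDegree_pow, hg, mul_comm (u / N)]
    exact (Nat.mod_add_div u N).le
  have hBt : ∀ t, (B t).coeff t = g.coeff N ^ (t / N) := by
    intro t
    have e : t - t % N = t / N * N := by
      have := Nat.mod_add_div t N
      rw [mul_comm (t / N)]; omega
    rw [Polynomial.coeff_X_pow_mul', if_pos (Nat.mod_le t N), e, ← hg,
      Polynomial.coeff_pow_mul_natDegree, Polynomial.leadingCoeff]
  have hx := sum_le_of_triangular (β := ‖g.coeff N‖ ^ d) (ε := ε) (pow_pos hβ d)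
    (pow_le_one₀ hβ.le ha1) M (fun t => ‖c t‖) (fun t => norm_nonneg _) hε ?_
  · have e := sum_range_mul_divMod hN (d + 1) (fun j i => ‖(p j).coeff i‖)
    rw [← e]
    linarith
  · intro t ht
    have h1 : (∑ j ∈ Finset.range (d + 1), p j * g ^ j).coeff t =
        c t * g.coeff N ^ (t / N) + ∑ u ∈ Finset.Ico (t + 1) M, c u * (B u).coeff t := by
      rw [hBQ, Polynomial.finsetSum_coeff, Finset.range_eq_Ico,
        ← Finset.sum_Ico_consecutive _ (Nat.zero_le t) ht.le, Finset.sum_eq_sum_Ico_succ_bot ht,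
        Finset.sum_eq_zero, zero_add]
      · simp only [Polynomial.coeff_C_mul, hBt]
      · intro u hu
        rw [Polynomial.coeff_C_mul, hB0 t u (Finset.mem_Ico.mp hu).2, mul_zero]
    have h2 : ‖∑ u ∈ Finset.Ico (t + 1) M, c u * (B u).coeff t‖ ≤
        ∑ u ∈ Finset.Ico (t + 1) M, ‖c u‖ := by
      refine norm_sum_le_of_le _ fun u hu => ?_
      rw [norm_mul]
      exact mul_le_of_le_one_right (norm_nonneg _) (hB1 u (Finset.mem_Ico.mp hu).2 t ht)
    have h3 : ‖c t * g.coeff N ^ (t / N)‖ ≤ ε + ∑ u ∈ Finset.Ico (t + 1) M, ‖c u‖ := by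
      rw [eq_sub_of_add_eq h1.symm]
      exact (norm_sub_le _ _).trans (add_le_add (hQ t ht) h2)
    rw [norm_mul, norm_pow] at h3
    refine le_trans ?_ h3
    rw [mul_comm]
    exact mul_le_mul_of_nonneg_left (pow_le_pow_of_le_one hβ.le ha1 (hdiv t ht)) (norm_nonneg _)

/-- Some coefficient of `∑ p_j g ^ j` is at least a multiple of the sum of the norms of the
coefficients of the `p_j`. -/
theorem exists_norm_coeff_ge {g : ℂ[X]} {N d : ℕ} (hdN : d < N) (hg : g.natDegree = N)
    (ha1 : ‖g.coeff N‖ ≤ 1) (ha0 : g.coeff N ≠ 0) {p : Fin (d + 1) → ℂ[X]}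
    (hp : ∀ j, (p j).natDegree ≤ d)
    (hgc : ∀ j ≤ d, ∀ m < N * (d + 1), ‖(g ^ j).coeff m‖ ≤ 1) :
    ∃ m < N * (d + 1), ∑ j, ∑ i ∈ Finset.range N, ‖(p j).coeff i‖ ≤
      (2 / ‖g.coeff N‖ ^ d) ^ (N * (d + 1)) * ‖(∑ j, p j * g ^ (j : ℕ)).coeff m‖ := by
  have hN : 0 < N := by omega
  let p' : ℕ → ℂ[X] := fun j => if h : j < d + 1 then p ⟨j, h⟩ else 0
  have hp' : ∀ j : Fin (d + 1), p' j = p j := fun j => dif_pos j.2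
  have e1 : ∑ j, p j * g ^ (j : ℕ) = ∑ j ∈ Finset.range (d + 1), p' j * g ^ j := by
    rw [← Fin.sum_univ_eq_sum_range (fun j => p' j * g ^ j)]
    simp only [hp']
  have e2 : ∑ j, ∑ i ∈ Finset.range N, ‖(p j).coeff i‖ =
      ∑ j ∈ Finset.range (d + 1), ∑ i ∈ Finset.range N, ‖(p' j).coeff i‖ := by
    rw [← Fin.sum_univ_eq_sum_range (fun j => ∑ i ∈ Finset.range N, ‖(p' j).coeff i‖)]
    simp only [hp']
  obtain ⟨m, hm, hmax⟩ := Finset.exists_max_image (Finset.range (N * (d + 1)))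
    (fun m => ‖(∑ j, p j * g ^ (j : ℕ)).coeff m‖) ⟨0, by simp [hN]⟩
  refine ⟨m, Finset.mem_range.mp hm, ?_⟩
  rw [e2]
  refine sum_norm_coeff_le hN hg ha1 ha0 (fun j => ?_) hgc (norm_nonneg _) fun k hk => ?_
  · simp only [p']
    split_ifs
    · exact (hp _).trans_lt hdN
    · simpa using hN
  · rw [← e1]
    exact hmax k (Finset.mem_range.mpr hk)

/-! ### Two-variable polynomials and power series -/

/-- A polynomial in two variables of total degree at most `d`, as a combination of powers of the
second variable. -/
theorem exists_eval_eq_sum {P : MvPolynomial (Fin 2) ℂ} (hP : P ≠ 0) {d : ℕ}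
    (hd : P.totalDegree ≤ d) :
    ∃ p : Fin (d + 1) → ℂ[X], p ≠ 0 ∧ (∀ j, (p j).natDegree ≤ d) ∧
      ∀ z y : ℂ, MvPolynomial.eval ![z, y] P = ∑ j, (p j).eval z * y ^ (j : ℕ) := by
  have hle : ∀ m ∈ P.support, m 0 + m 1 ≤ d := fun m hm => by
    have := (MvPolynomial.le_totalDegree hm).trans hd
    rwa [Finsupp.sum_fintype _ _ (fun _ => rfl), Fin.sum_univ_two] at this
  let p : Fin (d + 1) → ℂ[X] := fun j => ∑ m ∈ P.support with m 1 = (j : ℕ),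
    Polynomial.C (P.coeff m) * Polynomial.X ^ (m 0)
  refine ⟨p, ?_, fun j => ?_, fun z y => ?_⟩
  · obtain ⟨m, hm⟩ := MvPolynomial.support_nonempty.mpr hP
    intro h0
    have h1 : (p ⟨m 1, by have := hle m hm; omega⟩).coeff (m 0) = P.coeff m := by
      simp only [p, Polynomial.finsetSum_coeff, Polynomial.coeff_C_mul_X_pow]
      rw [Finset.sum_eq_single m]
      · simp
      · intro u hu hum
        rw [if_neg]
        intro h
        refine hum (Finsupp.ext fun i => ?_)
        have h' := (Finset.mem_filter.mp hu).2
        fin_cases i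
        · exact h.symm
        · exact h'
      · intro h
        exact absurd (by simpa using hm) h
    rw [h0] at h1
    exact MvPolynomial.mem_support_iff.mp hm (by simpa using h1.symm)
  · refine Polynomial.natDegree_sum_le_of_forall_le _ _ fun m hm => ?_
    have := hle m (Finset.mem_filter.mp hm).1
    exact (Polynomial.natDegree_C_mul_X_pow_le _ _).trans (by omega)
  · have key : ∀ j : Fin (d + 1), (p j).eval z * y ^ (j : ℕ) =
        ∑ m ∈ P.support with m 1 = (j : ℕ), P.coeff m * (z ^ m 0 * y ^ m 1) := by
      intro j
      simp only [p, Polynomial.eval_finsetSum, Finset.sum_mul]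
      refine Finset.sum_congr rfl fun m hm => ?_
      rw [(Finset.mem_filter.mp hm).2]
      simp [mul_assoc]
    rw [MvPolynomial.eval_eq', Finset.sum_congr rfl fun j _ => key j,
      Fin.sum_univ_eq_sum_range
        (fun j => ∑ m ∈ P.support with m 1 = j, P.coeff m * (z ^ m 0 * y ^ m 1)),
      Finset.sum_fiberwise_of_maps_to]
    · simp [Fin.prod_univ_two]
    · intro m hm
      have := hle m hm
      exact Finset.mem_range.mpr (by omega)

/-- A power series on the unit disc agrees with its partial sums. -/
theorem agreesUpTo_of_hasSum {f : ℂ → ℂ} {b : ℕ → ℂ} {e : ℕ → ℕ}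
    (hf : ∀ z ∈ ball (0 : ℂ) 1, HasSum (fun k => b k * z ^ e k) (f z)) {K L : ℕ}
    (hL : ∀ k, K ≤ k → L ≤ e k) :
    AgreesUpTo L f (∑ k ∈ Finset.range K, Polynomial.C (b k) * Polynomial.X ^ e k) := by
  let h : ℂ → ℂ := fun z => ∑' k, b (k + K) * z ^ (e (k + K) - L)
  refine ⟨h, fun z hz => ?_, fun z hz => ?_⟩
  · obtain ⟨ρ, hzρ, hρ1⟩ := exists_between (mem_ball_zero_iff.mp hz)
    have hρ0 : 0 < ρ := (norm_nonneg z).trans_lt hzρ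
    have hρ : (ρ : ℂ) ∈ ball (0 : ℂ) 1 := by
      rw [mem_ball_zero_iff, Complex.norm_real, Real.norm_of_nonneg hρ0.le]
      exact hρ1
    have hs : Summable fun k => ‖b (k + K)‖ * ρ ^ (e (k + K) - L) := by
      have h1 := ((summable_nat_add_iff K).mpr (hf _ hρ).summable.norm).mul_left ((ρ ^ L)⁻¹)
      refine h1.congr fun k => ?_
      have h2 : e (k + K) = L + (e (k + K) - L) := by
        have := hL (k + K) (by omega); omega
      rw [norm_mul, norm_pow, Complex.norm_real, Real.norm_of_nonneg hρ0.le]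
      conv_lhs => rw [h2, pow_add]
      field_simp
    have hd : DifferentiableOn ℂ h (ball 0 ρ) := by
      refine Complex.differentiableOn_tsum_of_summable_norm hs (fun k => ?_) isOpen_ball
        fun k w hw => ?_
      · exact Differentiable.differentiableOn (by fun_prop)
      · rw [norm_mul, norm_pow]
        have := (mem_ball_zero_iff.mp hw).le
        gcongr
    exact (hd.differentiableAt (isOpen_ball.mem_nhds (mem_ball_zero_iff.mpr hzρ)))
      |>.differentiableWithinAt
  · have h1 := (hf z hz).summable.sum_add_tsum_nat_add K
    rw [(hf z hz).tsum_eq] at h1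
    rw [← h1, Polynomial.eval_finsetSum]
    congr 1
    · simp
    · rw [← tsum_mul_left]
      refine tsum_congr fun k => ?_
      rw [mul_left_comm, ← pow_add, Nat.add_sub_of_le (hL (k + K) (by omega))]

/-! ### Order and zeros of one combination -/

variable {f : ℂ → ℂ} {g : ℂ[X]} {N L d : ℕ} {p : Fin (d + 1) → ℂ[X]}

theorem exists_coeff_polyCombination_ge (hbound : ∀ z ∈ ball (0 : ℂ) 1, ‖f z‖ ≤ 1)
    (hfg : AgreesUpTo L f g) (hg : g.natDegree = N) (ha0 : g.coeff N ≠ 0) (hdN : d < N)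
    (hNL : N * (d + 1) ≤ L) (hp : ∀ j, (p j).natDegree ≤ d) :
    ∃ m < N * (d + 1), ∑ j, ∑ i ∈ Finset.range N, ‖(p j).coeff i‖ ≤
      (2 / ‖g.coeff N‖ ^ d) ^ (N * (d + 1)) * ‖(∑ j, p j * g ^ (j : ℕ)).coeff m‖ := by
  have hc : ∀ j ≤ d, ∀ m < N * (d + 1), ‖(g ^ j).coeff m‖ ≤ 1 := fun j _ m hm =>
    (hfg.pow j).norm_coeff_le_one (hm.trans_le hNL) fun z hz => by
      rw [norm_pow]
      exact pow_le_one₀ (norm_nonneg _) (hbound z hz)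
  -- For d = 0 the index N is not below N(d+1), so the leading coefficient of g need not be known to
  -- be at most 1; but then the combination is a constant.
  rcases Nat.eq_zero_or_pos d with rfl | hd
  · refine ⟨(p 0).natDegree, by have := hp 0; omega, ?_⟩
    have h0 : ∀ i ∈ Finset.range N, i ≠ 0 → ‖(p 0).coeff i‖ = 0 := fun i _ hi => by
      rw [Polynomial.coeff_eq_zero_of_natDegree_lt ((hp 0).trans_lt (by omega)), norm_zero]
    have e0 : (p 0).natDegree = 0 := Nat.le_zero.mp (hp 0)
    simp only [Nat.reduceAdd, Finset.univ_unique, Fin.default_eq_zero, Finset.sum_singleton,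
      Fin.val_zero, pow_zero, mul_one, div_one, e0, Fin.isValue]
    rw [Finset.sum_eq_single 0 h0 (by simp; omega)]
    exact le_mul_of_one_le_left (norm_nonneg _) (one_le_pow₀ (by norm_num))
  · have h1 := hc 1 hd N (by nlinarith)
    rw [pow_one] at h1
    exact exists_norm_coeff_ge hdN hg h1 ha0 hp hc

theorem sum_norm_coeff_pos (hp0 : p ≠ 0) (hdN : d < N) (hp : ∀ j, (p j).natDegree ≤ d) :
    0 < ∑ j, ∑ i ∈ Finset.range N, ‖(p j).coeff i‖ := by
  obtain ⟨j, hj⟩ := Function.ne_iff.mp hp0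
  refine Finset.sum_pos' (fun j _ => Finset.sum_nonneg fun i _ => norm_nonneg _)
    ⟨j, Finset.mem_univ _, Finset.sum_pos' (fun i _ => norm_nonneg _)
      ⟨(p j).natDegree, Finset.mem_range.mpr ((hp j).trans_lt hdN), ?_⟩⟩
  exact norm_pos_iff.mpr (Polynomial.leadingCoeff_ne_zero.mpr hj)

theorem norm_polyCombination_le (hbound : ∀ z ∈ ball (0 : ℂ) 1, ‖f z‖ ≤ 1) (hdN : d < N)
    (hp : ∀ j, (p j).natDegree ≤ d) {z : ℂ} (hz : z ∈ ball (0 : ℂ) 1) :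
    ‖polyCombination f p z‖ ≤ ∑ j, ∑ i ∈ Finset.range N, ‖(p j).coeff i‖ := by
  refine norm_sum_le_of_le _ fun j _ => ?_
  rw [norm_mul, norm_pow]
  refine (mul_le_of_le_one_right (norm_nonneg _)
    (pow_le_one₀ (norm_nonneg _) (hbound z hz))).trans ?_
  rw [Polynomial.eval_eq_sum_range' ((hp j).trans_lt hdN)]
  refine norm_sum_le_of_le _ fun i _ => ?_
  rw [norm_mul, norm_pow]
  exact mul_le_of_le_one_right (norm_nonneg _)
    (pow_le_one₀ (norm_nonneg _) (mem_ball_zero_iff.mp hz).le)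

theorem order_polyCombination_lt (hbound : ∀ z ∈ ball (0 : ℂ) 1, ‖f z‖ ≤ 1)
    (hfg : AgreesUpTo L f g) (hg : g.natDegree = N) (ha0 : g.coeff N ≠ 0) (hdN : d < N)
    (hNL : N * (d + 1) ≤ L) (hp0 : p ≠ 0) (hp : ∀ j, (p j).natDegree ≤ d) :
    analyticOrderAt (polyCombination f p) 0 < L := by
  obtain ⟨m, hm, h⟩ := exists_coeff_polyCombination_ge hbound hfg hg ha0 hdN hNL hp
  refine (hfg.polyCombination p).order_lt (hm.trans_le hNL) fun h0 => ?_
  rw [h0, norm_zero, mul_zero] at h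
  exact (sum_norm_coeff_pos hp0 hdN hp).not_ge h

theorem pow_le_of_zeros (hbound : ∀ z ∈ ball (0 : ℂ) 1, ‖f z‖ ≤ 1)
    (hfg : AgreesUpTo L f g) (hg : g.natDegree = N) (ha0 : g.coeff N ≠ 0) (hdN : d < N)
    (hNL : N * (d + 1) ≤ L) (hp0 : p ≠ 0) (hp : ∀ j, (p j).natDegree ≤ d) {s : Finset ℂ}
    (hs : (s : Set ℂ) ⊆ closedBall 0 (1 / 4)) {k : ℕ}
    (hk : (k : ℕ∞) ≤ ∑ z ∈ s, analyticOrderAt (polyCombination f p) z) :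
    (5 / 3 : ℝ) ^ k ≤ (16 / ‖g.coeff N‖ ^ d) ^ (N * (d + 1)) := by
  obtain ⟨m, hm, h⟩ := exists_coeff_polyCombination_ge hbound hfg hg ha0 hdN hNL hp
  have hX := sum_norm_coeff_pos hp0 hdN hp
  set X := ∑ j, ∑ i ∈ Finset.range N, ‖(p j).coeff i‖
  have hF := hfg.polyCombination p
  have h1 := norm_le_of_zeros s (fun w hw => mem_closedBall_zero_iff.mp (hs hw)) k
    (polyCombination f p) X hF.differentiableOn
    (fun z hz => norm_polyCombination_le hbound hdN hp
      (sphere_subset_closedBall.trans (closedBall_subset_ball (by norm_num)) hz)) hk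
  -- Cauchy on the circle |z| = 1/8, where the zeros have made F small; it costs 8^m ≤ 8^M.
  have h2 := hF.norm_coeff_mul_pow_le (hm.trans_le hNL) (r := 1 / 8) (by norm_num) (by norm_num)
    fun z hz => h1 z (mem_sphere_zero_iff_norm.mp hz).le
  have hβ : 0 < ‖g.coeff N‖ ^ d := pow_pos (norm_pos_iff.mpr ha0) d
  set β := ‖g.coeff N‖ ^ d
  set M := N * (d + 1)
  set c := ‖(∑ j, p j * g ^ (j : ℕ)).coeff m‖
  have h3 : c ≤ X * (3 / 5) ^ k * 8 ^ M := by
    have e8 : (1 / 8 : ℝ) ^ m * 8 ^ m = 1 := by rw [← mul_pow]; norm_num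
    calc c = c * (1 / 8) ^ m * 8 ^ m := by rw [mul_assoc, e8, mul_one]
      _ ≤ X * (3 / 5) ^ k * 8 ^ M := by
        gcongr
        norm_num
  have h4 : X * 1 ≤ X * ((16 / β) ^ M * (3 / 5) ^ k) :=
    calc X * 1 ≤ (2 / β) ^ M * (X * (3 / 5) ^ k * 8 ^ M) := by
          rw [mul_one]
          exact h.trans (by gcongr)
      _ = X * ((2 / β * 8) ^ M * (3 / 5) ^ k) := by rw [mul_pow]; ring
      _ = X * ((16 / β) ^ M * (3 / 5) ^ k) := by congr 3; ring
  have h5 := le_of_mul_le_mul_left h4 hX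
  have e5 : (5 / 3 : ℝ) ^ k * (3 / 5) ^ k = 1 := by rw [← mul_pow]; norm_num
  rw [← e5] at h5
  exact le_of_mul_le_mul_right h5 (by positivity)

/-! ### From inequalities to counts -/

/-- Take logarithms, with log (5/3) ≥ 1/2 and log 16 ≤ 3. -/
theorem card_zeros_le {B : ℝ} {k d M : ℕ} {α : ℝ} (hα : 0 < α) (hB : Real.exp (-B) ≤ α)
    (h : (5 / 3 : ℝ) ^ k ≤ (16 / α ^ d) ^ M) : (k : ℝ) ≤ 2 * M * (3 + d * B) := by
  have h53 : (1 / 2 : ℝ) ≤ Real.log (5 / 3) := by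
    have e : (2 : ℝ) * Real.log (5 / 3) = Real.log ((5 / 3) ^ 2) := by simp [Real.log_pow]
    have : (1 : ℝ) ≤ Real.log ((5 / 3) ^ 2) := by
      rw [Real.le_log_iff_exp_le (by norm_num)]
      linarith [Real.exp_one_lt_d9]
    linarith
  have h16 : Real.log 16 ≤ 3 := by
    rw [show (16 : ℝ) = 2 ^ 4 by norm_num, Real.log_pow]
    push_cast
    linarith [Real.log_two_lt_d9]
  have hlα : -B ≤ Real.log α := (Real.le_log_iff_exp_le hα).mpr hB
  have h1 := Real.log_le_log (by positivity) h
  rw [Real.log_pow, Real.log_pow, Real.log_div (x := 16) (by norm_num) (by positivity),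
    Real.log_pow] at h1
  have h2 : Real.log 16 - d * Real.log α ≤ 3 + d * B := by
    have := mul_le_mul_of_nonneg_left hlα (Nat.cast_nonneg (α := ℝ) d)
    linarith
  have h3 := mul_le_mul_of_nonneg_left h2 (Nat.cast_nonneg (α := ℝ) M)
  have h4 := mul_le_mul_of_nonneg_left h53 (Nat.cast_nonneg (α := ℝ) k)
  linarith

theorem BoundedBy.of_le {m : ℕ∞} {k : ℕ} {x : ℝ} (h : m ≤ k) (hk : (k : ℝ) ≤ x) :
    BoundedBy m x := by
  obtain ⟨l, rfl⟩ := ENat.ne_top_iff_exists.mp (ne_top_of_le_ne_top (ENat.natCast_ne_top k) h)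
  exact ⟨l, rfl, (Nat.cast_le.mpr (by exact_mod_cast h)).trans hk⟩

theorem BoundedBy.mono {m m' : ℕ∞} {x : ℝ} (h : BoundedBy m x) (hm : m' ≤ m) :
    BoundedBy m' x := by
  obtain ⟨k, rfl, hk⟩ := h
  exact .of_le hm hk

theorem encard_zeros_le_zeroCountMult {F : ℂ → ℂ} {D : Set ℂ}
    (hF : ∀ z ∈ D, AnalyticAt ℂ F z) : {z ∈ D | F z = 0}.encard ≤ zeroCountMult F D := by
  have key : ∀ t : Finset ℂ, (t : Set ℂ) ⊆ {z ∈ D | F z = 0} →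
      (t.card : ℕ∞) ≤ zeroCountMult F D := by
    intro t ht
    refine le_trans ?_ (le_iSup₂_of_le t (fun z hz => (ht hz).1) le_rfl)
    rw [Finset.card_eq_sum_ones, Nat.cast_sum]
    refine Finset.sum_le_sum fun z hz => ?_
    rw [Nat.cast_one, Order.one_le_iff_ne_zero, (hF z (ht hz).1).analyticOrderAt_ne_zero]
    exact (ht hz).2
  refine ENat.forall_natCast_le_iff_le.mp fun k hk => ?_
  obtain ⟨t, ht, htk⟩ := Set.exists_subset_encard_eq hk
  have hfin : t.Finite := Set.finite_of_encard_eq_coe htk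
  have h1 := key hfin.toFinset (by simpa using ht)
  rwa [← Set.encard_coe_eq_coe_finsetCard, hfin.coe_toFinset, htk] at h1

theorem transcendenceIndex_mono (f : ℂ → ℂ) : Monotone (transcendenceIndex f) := fun _ _ h =>
  iSup_mono fun _ => iSup_mono fun _ => iSup_mono' fun hd => ⟨hd.trans h, le_rfl⟩

/-! ### Lacunary exponents -/

section Lacunary

variable {n : ℕ → ℕ} {q : ℝ}

/-- The values 0 and 1 are fixed by squaring and by the q-th power, so the two growth conditions
would contradict each other. -/
theorem two_le_exponent (hq : 0 < q)
    (hn : ∀ k : ℕ, 1 ≤ k → n k ^ 2 < n (k + 1) ∧ (n (k + 1) : ℝ) ≤ (n k : ℝ) ^ q) {k : ℕ}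
    (hk : 1 ≤ k) : 2 ≤ n k := by
  obtain ⟨h1, h2⟩ := hn k hk
  by_contra! hcon
  interval_cases n k
  · rw [Nat.cast_zero, Real.zero_rpow hq.ne'] at h2
    have : n (k + 1) ≤ 0 := by exact_mod_cast h2
    omega
  · rw [Nat.cast_one, Real.one_rpow] at h2
    have : n (k + 1) ≤ 1 := by exact_mod_cast h2
    omega

theorem exponent_strictMono (hq : 0 < q)
    (hn : ∀ k : ℕ, 1 ≤ k → n k ^ 2 < n (k + 1) ∧ (n (k + 1) : ℝ) ≤ (n k : ℝ) ^ q) :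
    StrictMono fun k => n (k + 1) := by
  refine strictMono_nat_of_lt_succ fun k => ?_
  have := two_le_exponent hq hn (k := k + 1) (by omega)
  have := (hn (k + 1) (by omega)).1
  nlinarith

theorem exists_exponent_le_lt (hq : 0 < q)
    (hn : ∀ k : ℕ, 1 ≤ k → n k ^ 2 < n (k + 1) ∧ (n (k + 1) : ℝ) ≤ (n k : ℝ) ^ q) {d : ℕ}
    (hd : n 1 ≤ d) : ∃ K, 1 ≤ K ∧ n K ≤ d ∧ d < n (K + 1) := by
  classical
  have hex : ∃ k, d < n (k + 1) :=
    ⟨d + 1, (Nat.lt_succ_self d).trans_le ((exponent_strictMono hq hn).id_le (d + 1))⟩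
  have hpos : Nat.find hex ≠ 0 := fun h => by
    have := Nat.find_spec hex
    rw [h] at this
    simp only [zero_add] at this
    omega
  refine ⟨Nat.find hex, Nat.one_le_iff_ne_zero.mpr hpos, ?_, Nat.find_spec hex⟩
  have := Nat.find_min hex (Nat.sub_lt (Nat.pos_of_ne_zero hpos) one_pos)
  rwa [Nat.sub_add_cancel (Nat.one_le_iff_ne_zero.mpr hpos), not_lt] at this

/-- For `d ≥ n_1`, the function `f` is approximated at `0` by a partial sum `g` of degree
between `d` and `d ^ q`, to an order `L` larger than `(d + 1) deg g` and at most `d ^ (q ^ 2)`. -/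
theorem exists_partialSum {f : ℂ → ℂ} {a : ℕ → ℂ} (hq : 0 < q)
    (hf : ∀ z ∈ ball (0 : ℂ) 1, HasSum (fun k : ℕ => a (k + 1) * z ^ n (k + 1)) (f z))
    (ha : ∀ k : ℕ, 1 ≤ k → a k ≠ 0)
    (hn : ∀ k : ℕ, 1 ≤ k → n k ^ 2 < n (k + 1) ∧ (n (k + 1) : ℝ) ≤ (n k : ℝ) ^ q) {d : ℕ}
    (hd : n 1 ≤ d) :
    ∃ (K L : ℕ) (g : ℂ[X]), 1 ≤ K ∧ AgreesUpTo L f g ∧ g.natDegree = n K ∧ g.coeff (n K) = a K ∧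
      d < n K ∧ n K * (d + 1) ≤ L ∧ (n K : ℝ) ≤ (d : ℝ) ^ q ∧ (L : ℝ) ≤ (d : ℝ) ^ (q ^ 2) := by
  obtain ⟨K, hK1, hKd, hdK⟩ := exists_exponent_le_lt hq hn hd
  have hmono := exponent_strictMono hq hn
  have hN : (n (K + 1) : ℝ) ≤ (d : ℝ) ^ q := (hn K hK1).2.trans <|
    Real.rpow_le_rpow (Nat.cast_nonneg _) (Nat.cast_le.mpr hKd) hq.le
  have hcoeff : ∀ m, (∑ k ∈ Finset.range (K + 1),
      Polynomial.C (a (k + 1)) * Polynomial.X ^ n (k + 1)).coeff m =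
      ∑ k ∈ Finset.range (K + 1), if m = n (k + 1) then a (k + 1) else 0 := fun m => by
    rw [Polynomial.finsetSum_coeff]
    exact Finset.sum_congr rfl fun k _ => Polynomial.coeff_C_mul_X_pow _ _ _
  have htop : (∑ k ∈ Finset.range (K + 1),
      Polynomial.C (a (k + 1)) * Polynomial.X ^ n (k + 1)).coeff (n (K + 1)) = a (K + 1) := by
    rw [hcoeff, Finset.sum_eq_single K]
    · simp
    · intro k hk hkK
      rw [if_neg fun h => hkK (hmono.injective h.symm)]
    · simp
  refine ⟨K + 1, n (K + 2), _, by omega,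
    agreesUpTo_of_hasSum hf fun k hk => hmono.monotone hk, ?_, htop, hdK, ?_, hN, ?_⟩
  · refine le_antisymm ?_ (Polynomial.le_natDegree_of_ne_zero ?_)
    · refine Polynomial.natDegree_sum_le_of_forall_le _ _ fun k hk => ?_
      exact (Polynomial.natDegree_C_mul_X_pow_le _ _).trans
        (hmono.monotone (by have := Finset.mem_range.mp hk; omega))
    · rw [htop]
      exact ha _ (by omega)
  · have := (hn (K + 1) (by omega)).1
    calc n (K + 1) * (d + 1) ≤ n (K + 1) * n (K + 1) := by gcongr; omega
      _ ≤ n (K + 2) := by rw [← sq]; exact this.le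
  · calc (n (K + 2) : ℝ) ≤ (n (K + 1) : ℝ) ^ q := (hn (K + 1) (by omega)).2
      _ ≤ ((d : ℝ) ^ q) ^ q := Real.rpow_le_rpow (Nat.cast_nonneg _) hN hq.le
      _ = (d : ℝ) ^ (q ^ 2) := by rw [← Real.rpow_mul (Nat.cast_nonneg _), sq]

end Lacunary

theorem zeros_bound_arith {d N : ℕ} {p q B : ℝ} (hp : 0 < p) (hq : 2 < q) (hd : 1 ≤ d)
    (hN : (N : ℝ) ≤ (d : ℝ) ^ q) (hB : B = (N : ℝ) ^ p) :
    2 * ((N * (d + 1) : ℕ) : ℝ) * (3 + d * B) ≤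
      10 * (2 * (d : ℝ)) ^ (q ^ 2) * (1 + q * (d : ℝ) ^ 2 + 5 * (d : ℝ) ^ (p * q + 3)) := by
  have hd1 : (1 : ℝ) ≤ d := by exact_mod_cast hd
  have hd0 : (0 : ℝ) ≤ d := by linarith
  have hNW : (N : ℝ) ≤ (2 * (d : ℝ)) ^ (q ^ 2) :=
    calc (N : ℝ) ≤ (d : ℝ) ^ q := hN
      _ ≤ (d : ℝ) ^ (q ^ 2) := Real.rpow_le_rpow_of_exponent_le hd1 (by nlinarith)
      _ ≤ _ := Real.rpow_le_rpow hd0 (by linarith) (by positivity)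
  have hBE : B ≤ (d : ℝ) ^ (p * q) := by
    rw [hB, mul_comm p, Real.rpow_mul hd0]
    exact Real.rpow_le_rpow (Nat.cast_nonneg _) hN hp.le
  have hE : (d : ℝ) ^ (p * q + 3) = (d : ℝ) ^ (p * q) * (d : ℝ) ^ 3 := by
    rw [Real.rpow_add (by linarith)]
    norm_cast
  rw [hE]
  set E := (d : ℝ) ^ (p * q)
  set W := (2 * (d : ℝ)) ^ (q ^ 2)
  have hE0 : 0 ≤ E := by positivity
  have hW0 : 0 ≤ W := by positivity
  have h1 : 2 * ((d : ℝ) + 1) * (3 + d * E) ≤ 10 * (1 + q * (d : ℝ) ^ 2 + 5 * (E * (d : ℝ) ^ 3)) := by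
    have e1 : (d : ℝ) ≤ d ^ 2 := by nlinarith
    have e2 : (d : ℝ) ^ 2 ≤ d ^ 3 := by nlinarith
    have e3 : E * d ≤ E * d ^ 3 := mul_le_mul_of_nonneg_left (e1.trans e2) hE0
    have e4 : E * d ^ 2 ≤ E * d ^ 3 := mul_le_mul_of_nonneg_left e2 hE0
    have e5 : 2 * (d : ℝ) ^ 2 ≤ q * d ^ 2 := by gcongr
    nlinarith
  push_cast
  calc 2 * ((N : ℝ) * (d + 1)) * (3 + d * B) ≤ 2 * (W * (d + 1)) * (3 + d * E) := by
        have : 0 ≤ B := by rw [hB]; positivity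
        gcongr
    _ = W * (2 * ((d : ℝ) + 1) * (3 + d * E)) := by ring
    _ ≤ W * (10 * (1 + q * (d : ℝ) ^ 2 + 5 * (E * (d : ℝ) ^ 3))) := by gcongr
    _ = _ := by ring

end Bezout

open Bezout Metric in
theorem mainTheorem3
    (f : ℂ → ℂ) (a : ℕ → ℂ) (n : ℕ → ℕ) (q : ℝ) (hq : 2 < q)
    -- `f(z) = ∑_{k ≥ 1} a_k z^{n_k}` on the unit disc, bounded there by `1`, with all `a_k ≠ 0`
    (hf : ∀ z ∈ Metric.ball (0 : ℂ) 1,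
      HasSum (fun k : ℕ => a (k + 1) * z ^ n (k + 1)) (f z))
    (hbound : ∀ z ∈ Metric.ball (0 : ℂ) 1, ‖f z‖ ≤ 1)
    (ha : ∀ k : ℕ, 1 ≤ k → a k ≠ 0)
    (hn : ∀ k : ℕ, 1 ≤ k → n k ^ 2 < n (k + 1) ∧ (n (k + 1) : ℝ) ≤ (n k : ℝ) ^ q) :
    -- the transcendence sequence grows at most polynomially
    (∃ R : Polynomial ℝ, ∀ d : ℕ, 1 ≤ d →
      Bezout.BoundedBy (Bezout.transcendenceIndex f d) (R.eval (d : ℝ))) ∧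
    -- `ν_d(f) < d ^ (q ^ 2)`
    (∀ d : ℕ, n 1 ≤ d →
      ∃ ν : ℕ, Bezout.transcendenceIndex f d = ν ∧ (ν : ℝ) < (d : ℝ) ^ (q ^ 2)) ∧
    -- the bound for the number of zeros in the closed disc of radius `1 / 4`
    (∀ p : ℝ, 0 < p → (∀ k : ℕ, 1 ≤ k → Real.exp (-((n k : ℝ) ^ p)) ≤ ‖a k‖) →
      ∀ d : ℕ, n 1 ≤ d →
        Bezout.BoundedBy (Bezout.bezoutNumber f (Metric.closedBall 0 (1 / 4)) d)
          (10 * (2 * (d : ℝ)) ^ (q ^ 2) *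
            (1 + q * (d : ℝ) ^ 2 + 5 * (d : ℝ) ^ (p * q + 3))) ∧
        Bezout.BoundedBy (Bezout.bezoutNumberMult f (Metric.closedBall 0 (1 / 4)) d)
          (10 * (2 * (d : ℝ)) ^ (q ^ 2) *
            (1 + q * (d : ℝ) ^ 2 + 5 * (d : ℝ) ^ (p * q + 3)))) := by
  have hq0 : 0 < q := by linarith
  have hn1 : 2 ≤ n 1 := two_le_exponent hq0 hn le_rfl
  have hν : ∀ d : ℕ, n 1 ≤ d →
      ∃ ν : ℕ, transcendenceIndex f d = ν ∧ (ν : ℝ) < (d : ℝ) ^ (q ^ 2) := by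
    intro d hd
    obtain ⟨K, L, g, hK, hfg, hg, hgK, hdN, hNL, -, hLd⟩ := exists_partialSum hq0 hf ha hn hd
    have hL : 0 < L := lt_of_lt_of_le (Nat.mul_pos (by omega) (Nat.succ_pos d)) hNL
    -- Bounding each order by L - 1 keeps the inequality strict after the supremum.
    have hle : transcendenceIndex f d ≤ (L - 1 : ℕ) := by
      refine iSup_le fun P => iSup₂_le fun hP hPd => ?_
      obtain ⟨p, hp0, hp, e⟩ := exists_eval_eq_sum hP hPd
      have h1 : (fun z : ℂ => MvPolynomial.eval ![z, f z] P) = polyCombination f p :=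
        funext fun z => e z (f z)
      have h2 := order_polyCombination_lt hbound hfg hg (hgK ▸ ha K hK) hdN hNL hp0 hp
      rw [h1]
      refine Order.le_of_lt_add_one ?_
      have h3 : ((L - 1 : ℕ) : ℕ∞) + 1 = L := by
        exact_mod_cast Nat.sub_add_cancel hL
      rwa [h3]
    obtain ⟨ν, h1, h2⟩ := BoundedBy.of_le hle le_rfl
    refine ⟨ν, h1, (lt_of_le_of_lt h2 ?_).trans_le hLd⟩
    exact_mod_cast Nat.sub_lt hL one_pos
  -- Monotonicity in d, through ν_d ≤ ν_{n_1 d}, also covers the degrees d < n_1.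
  refine ⟨⟨(Polynomial.C (n 1 : ℝ) * Polynomial.X) ^ ⌈q ^ 2⌉₊, fun d hd => ?_⟩, hν, ?_⟩
  · have hle : n 1 ≤ n 1 * d := Nat.le_mul_of_pos_right _ hd
    obtain ⟨ν, h1, h2⟩ := hν (n 1 * d) hle
    have hmono : transcendenceIndex f d ≤ ν :=
      h1 ▸ transcendenceIndex_mono f (Nat.le_mul_of_pos_left _ (by omega))
    refine .of_le hmono (h2.le.trans ?_)
    rw [Polynomial.eval_pow, Polynomial.eval_mul, Polynomial.eval_C, Polynomial.eval_X,
      ← Real.rpow_natCast _ ⌈q ^ 2⌉₊,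
      ← Nat.cast_mul]
    refine Real.rpow_le_rpow_of_exponent_le ?_ (Nat.le_ceil _)
    exact_mod_cast (by omega : 1 ≤ n 1 * d)
  · intro p hp hap d hd
    obtain ⟨K, L, g, hK, hfg, hg, hgK, hdN, hNL, hNd, -⟩ := exists_partialSum hq0 hf ha hn hd
    set B : ℝ := 10 * (2 * (d : ℝ)) ^ (q ^ 2) *
      (1 + q * (d : ℝ) ^ 2 + 5 * (d : ℝ) ^ (p * q + 3)) with hBdef
    have hB0 : 0 ≤ B := by positivity
    have hzeros : bezoutNumberMult f (closedBall 0 (1 / 4)) d ≤ ⌊B⌋₊ := by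
      refine iSup_le fun P => iSup₂_le fun hP0 hPd => iSup₂_le fun s hs => ?_
      by_contra! hcon
      have hk : ((⌊B⌋₊ + 1 : ℕ) : ℕ∞) ≤ ∑ z ∈ s, analyticOrderAt (polyCombination f P) z := by
        rw [Nat.cast_add, Nat.cast_one]
        exact Order.add_one_le_of_lt hcon
      have h1 := pow_le_of_zeros hbound hfg hg (hgK ▸ ha K hK) hdN hNL hP0 hPd hs hk
      rw [hgK] at h1
      have h2 := card_zeros_le (norm_pos_iff.mpr (ha K hK)) (hap K hK) h1
      have h3 := h2.trans (zeros_bound_arith hp hq (by omega) hNd rfl)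
      rw [← hBdef] at h3
      push_cast at h3
      linarith [Nat.lt_floor_add_one B]
    have hmult := BoundedBy.of_le hzeros (Nat.floor_le hB0)
    -- Every zero has order at least 1, so the count with multiplicity bounds the other one.
    refine ⟨hmult.mono (iSup_mono fun P => iSup_mono fun _ => iSup_mono fun _ => ?_), hmult⟩
    exact encard_zeros_le_zeroCountMult fun z hz =>
      (hfg.polyCombination P).analyticAt (closedBall_subset_ball (by norm_num) hz)
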